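/- All spaces are over $\mathbb{R}$. For Banach spaces $X,Y$ and a bounded linear operator $T:X\to Y$, write $S_X=\{x\in X:\|x\|=1\}$ and let $M_T=\{x\in S_X:\|Tx\|=\|T\|\}$ be the norm attainment set of $T$. For $\epsilon>0$ and operators $T,A:X\to Y$ with $\|T\|=\|A\|=1$, we say that $A$ is a uniform $\epsilon$-BPB approximation of $T$ if there exists $\delta>0$ such that for each $x_0\in S_X$ with $\|Tx_0\|>1-\delta$ there exists $u_0\in M_A$ with $\|u_0-x_0\|<\epsilon$ and $\|T-A\|<\epsilon$; it is called non-trivial if moreover $A\neq T$. The pair $(X,Y)$ has the non-trivial norm preserving uniform BPB approximation property if for every bounded linear operator $T:X\to Y$ with $\|T\|=1$ that is not an isometry and every $\epsilon>0$, there is a non-trivial uniform $\epsilon$-BPB approximation $A_\epsilon$ of $T$ with $M_T=M_{A_\epsilon}$. Let $n\in\mathbb{N}$ and let $\ell_\infty^n$ be $\mathbb{R}^n$ with the maximum norm. Let $T:\ell_\infty^n\to\ell_\infty^n$ be a linear operator with $\|T\|=1$. Then $T$ is an isometry if and only if there exists $\epsilon_0>0$ such that for each $0<\epsilon<\epsilon_0$,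 $T$ is the only uniform $\epsilon$-BPB approximation of $T$. Moreover, the pair $(\ell_\infty^n,\ell_\infty^n)$ has the non-trivial norm preserving uniform BPB approximation property. -/

import Mathlib

namespace BPB

/-- The real space `ℓ_∞^n`: in Mathlib the function space `Fin n → ℝ` carries the sup norm. -/
abbrev EllInfty (n : ℕ) : Type := Fin n → ℝ

section

variable {X Y : Type*} [NormedAddCommGroup X] [NormedSpace ℝ X]
  [NormedAddCommGroup Y] [NormedSpace ℝ Y]

/-- The norm attainment set `M_T` of a bounded linear operator `T`. -/
def normAttainmentSet (T : X →L[ℝ] Y) : Set X :=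
  {x | ‖x‖ = 1 ∧ ‖T x‖ = ‖T‖}

/-- `A` is a uniform `ε`-BPB approximation of `T`; both operators have norm one. -/
def IsUniformBPBApprox (ε : ℝ) (T A : X →L[ℝ] Y) : Prop :=
  ‖T‖ = 1 ∧ ‖A‖ = 1 ∧
    ∃ δ : ℝ, 0 < δ ∧ ∀ x₀ : X, ‖x₀‖ = 1 → 1 - δ < ‖T x₀‖ →
      ∃ u₀ ∈ normAttainmentSet A, ‖u₀ - x₀‖ < ε ∧ ‖T - A‖ < ε

/-- A uniform `ε`-BPB approximation of `T` that differs from `T`. -/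
def IsNontrivialUniformBPBApprox (ε : ℝ) (T A : X →L[ℝ] Y) : Prop :=
  IsUniformBPBApprox ε T A ∧ A ≠ T

end

/-- The pair `(X, Y)` has the non-trivial norm preserving uniform BPB approximation property. -/
def HasNontrivialNormPreservingUniformBPB (X Y : Type*) [NormedAddCommGroup X] [NormedSpace ℝ X]
    [NormedAddCommGroup Y] [NormedSpace ℝ Y] : Prop :=
  ∀ T : X →L[ℝ] Y, ‖T‖ = 1 → ¬ Isometry T → ∀ ε : ℝ, 0 < ε →
    ∃ A : X →L[ℝ] Y, IsNontrivialUniformBPBApprox ε T A ∧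
      normAttainmentSet T = normAttainmentSet A

end BPB

namespace BPB

/-! ### Compactness of the unit sphere -/

section FiniteDimensional

variable {X Y : Type*} [NormedAddCommGroup X] [NormedSpace ℝ X]
  [NormedAddCommGroup Y] [NormedSpace ℝ Y]

/-! View `T` as a matrix; contractivity says that every row has ℓ¹ mass at most 1. By compactness, a
contraction close to `T` with the same norming vectors is a uniform approximation. A non-isometry
has an entry of modulus strictly between 0 and 1, or a zero row, or exactly one entry ±1 in each row
with two rows using the same column. In the first two cases `T ± R` are contractions for some `R ≠
0`, and `T + c • R` with small `c` works (`exists_approx_of_segment`). In the third, shrinking one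
of the two parallel rows changes no `‖T x‖` (`exists_approx_of_parallel_rows`).

Conversely, an isometry is invertible, so composing with its inverse reduces its uniqueness to the
identity. There a norming vector near each basis vector forces the corresponding diagonal entry to
be 1, which exhausts its row (`eq_id_of_near`). -/

/-- Almost norming vectors of a norm one operator are close to norming ones, by compactness. -/
theorem exists_near_normAttainmentSet [ProperSpace X] (T : X →L[ℝ] Y) (hT : ‖T‖ = 1)
    {ε : ℝ} (hε : 0 < ε) :
    ∃ δ : ℝ, 0 < δ ∧ ∀ x : X, ‖x‖ = 1 → 1 - δ < ‖T x‖ →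
      ∃ u ∈ normAttainmentSet T, ‖u - x‖ < ε := by
  set K : Set X := {x | ‖x‖ = 1 ∧ ∀ u ∈ normAttainmentSet T, ε ≤ ‖u - x‖} with hK
  have hclosed : IsClosed K := by
    have : K = {x | ‖x‖ = 1} ∩ ⋂ u ∈ normAttainmentSet T, {x | ε ≤ ‖u - x‖} := by
      ext x; simp [hK]
    rw [this]
    refine (isClosed_eq continuous_norm continuous_const).inter ?_
    exact isClosed_biInter fun u _ => isClosed_le continuous_const (by fun_prop)
  have hcompact : IsCompact K :=
    (isCompact_closedBall (0 : X) 1).of_isClosed_subset hclosed fun x hx => by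
      simpa using hx.1.le
  rcases K.eq_empty_or_nonempty with h | h
  · refine ⟨1, one_pos, fun x hx _ => ?_⟩
    by_contra! hcon
    have : x ∈ K := ⟨hx, hcon⟩
    simp [h] at this
  · obtain ⟨z, hz, hmax⟩ := hcompact.exists_isMaxOn (f := fun x => ‖T x‖) h
      (by fun_prop)
    have hle : ‖T z‖ ≤ 1 := by simpa [hT, hz.1] using T.le_opNorm z
    have hlt : ‖T z‖ < 1 := by
      refine lt_of_le_of_ne hle fun heq => ?_
      have := hz.2 z ⟨hz.1, by rw [heq, hT]⟩
      simp at this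
      linarith
    refine ⟨1 - ‖T z‖, by linarith, fun x hx hTx => ?_⟩
    by_contra! hcon
    have : ‖T x‖ ≤ ‖T z‖ := hmax (show x ∈ K from ⟨hx, hcon⟩)
    linarith

theorem exists_unit_lt_norm_apply (T : X →L[ℝ] Y) (hT : ‖T‖ = 1) {δ : ℝ} (hδ : 0 < δ) :
    ∃ x : X, ‖x‖ = 1 ∧ 1 - δ < ‖T x‖ := by
  by_contra! hcon
  have h : ‖T‖ ≤ max (1 - δ) 0 := T.opNorm_le_of_unit_norm (le_max_right _ _) fun x hx =>
    (hcon x hx).trans (le_max_left _ _)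
  rw [hT] at h
  rcases le_max_iff.1 h with h | h <;> linarith

theorem normAttainmentSet_nonempty [ProperSpace X] (T : X →L[ℝ] Y) (hT : ‖T‖ = 1) :
    (normAttainmentSet T).Nonempty := by
  obtain ⟨δ, hδ, h⟩ := exists_near_normAttainmentSet T hT one_pos
  obtain ⟨x, hx, hTx⟩ := exists_unit_lt_norm_apply T hT hδ
  obtain ⟨u, hu, -⟩ := h x hx hTx
  exact ⟨u, hu⟩

/-- In finite dimensions, a nearby contraction attaining norm one exactly where `T` does is a
uniform approximation of `T`. -/
theorem isNontrivialUniformBPBApprox_of_norm_eq_one_iff [ProperSpace X] {T A : X →L[ℝ] Y}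
    (hT : ‖T‖ = 1) (hA : ‖A‖ ≤ 1) {ε : ℝ} (hTA : ‖T - A‖ < ε) (hne : A ≠ T)
    (h : ∀ x, ‖x‖ = 1 → (‖T x‖ = 1 ↔ ‖A x‖ = 1)) :
    IsNontrivialUniformBPBApprox ε T A ∧ normAttainmentSet T = normAttainmentSet A := by
  have hA1 : ‖A‖ = 1 := by
    obtain ⟨x, hx, hTx⟩ := normAttainmentSet_nonempty T hT
    have h1 := A.le_opNorm x
    rw [(h x hx).1 (hTx.trans hT), hx, mul_one] at h1
    exact le_antisymm hA h1
  have hM : normAttainmentSet T = normAttainmentSet A := by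
    ext x
    simp only [normAttainmentSet, Set.mem_ofPred_eq, hT, hA1]
    exact and_congr_right (h x)
  have hε : 0 < ε := (norm_nonneg _).trans_lt hTA
  obtain ⟨δ, hδ, hnear⟩ := exists_near_normAttainmentSet T hT hε
  refine ⟨⟨⟨hT, hA1, δ, hδ, fun x hx hTx => ?_⟩, hne⟩, hM⟩
  obtain ⟨u, hu, hux⟩ := hnear x hx hTx
  exact ⟨u, hM ▸ hu, hux, hTA⟩

end FiniteDimensional

/-! ### Rows of contractions -/

section EllInfty

variable {n : ℕ}

theorem norm_eq_one_iff_exists_abs {y : EllInfty n} (hy : ‖y‖ ≤ 1) :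
    ‖y‖ = 1 ↔ ∃ i, |y i| = 1 := by
  constructor
  · intro h
    by_contra! hcon
    have : ‖y‖ < 1 := (pi_norm_lt_iff one_pos).2 fun i =>
      lt_of_le_of_ne ((norm_le_pi_norm y i).trans hy) (hcon i)
    linarith
  · rintro ⟨i, hi⟩
    exact le_antisymm hy (hi ▸ norm_le_pi_norm y i)

theorem norm_single_one (i : Fin n) : ‖(Pi.single i 1 : EllInfty n)‖ = 1 :=
  (Pi.norm_single (G := fun _ : Fin n => ℝ) 1).trans norm_one

theorem apply_eq_sum (T : EllInfty n →L[ℝ] EllInfty n) (x : EllInfty n) (i : Fin n) :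
    T x i = ∑ j, x j * T (Pi.single j 1) i := by
  have h := LinearMap.pi_apply_eq_sum_univ (T : EllInfty n →ₗ[ℝ] EllInfty n) x
  have h' := congrFun h i
  simp only [ContinuousLinearMap.coe_coe, Finset.sum_apply, Pi.smul_apply, smul_eq_mul] at h'
  rw [h']
  refine Finset.sum_congr rfl fun j _ => ?_
  have hj : (fun k => if j = k then 1 else 0 : EllInfty n) = Pi.single j 1 := by
    funext k
    simp [Pi.single_apply, eq_comm]
  rw [hj]

/-- The mass of a row of a contraction outside the `j`-th entry `t` is at most `1 - |t|`. -/
theorem abs_apply_sub_le {T : EllInfty n →L[ℝ] EllInfty n} (hT : ‖T‖ ≤ 1) (i j : Fin n)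
    (x : EllInfty n) :
    |T x i - T (Pi.single j 1) i * x j| ≤ (1 - |T (Pi.single j 1) i|) * ‖x‖ := by
  set t := T (Pi.single j 1) i with ht
  -- Replacing the `j`-th coordinate of `x` by `s` does not increase the norm; `s = ±‖x‖` gives the
  -- claim.
  have key : ∀ s : ℝ, |s| ≤ ‖x‖ → |T x i - t * x j + t * s| ≤ ‖x‖ := by
    intro s hs
    set y : EllInfty n := x + (s - x j) • Pi.single j 1 with hy
    have hyn : ‖y‖ ≤ ‖x‖ := by
      refine (pi_norm_le_iff_of_nonneg (norm_nonneg _)).2 fun k => ?_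
      by_cases hk : k = j
      · subst hk; simpa [hy] using hs
      · simpa [hy, hk] using norm_le_pi_norm x k
    have h1 : |T y i| ≤ ‖x‖ := (norm_le_pi_norm (T y) i).trans
      ((T.le_of_opNorm_le hT y).trans (by simpa using hyn))
    have h2 : T y i = T x i - t * x j + t * s := by
      simp [hy, ht]; ring
    rwa [h2] at h1
  have h1 := abs_le.1 (key ‖x‖ (by simp))
  have h2 := abs_le.1 (key (-‖x‖) (by simp))
  rcases abs_cases t with ⟨h, _⟩ | ⟨h, _⟩ <;> rw [h] <;> apply abs_le.2 <;> constructor <;>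
    linarith [h1.1, h1.2, h2.1, h2.2]

theorem apply_eq_mul_of_abs_eq_one {T : EllInfty n →L[ℝ] EllInfty n} (hT : ‖T‖ ≤ 1)
    {i j : Fin n} (h : |T (Pi.single j 1) i| = 1) (x : EllInfty n) :
    T x i = T (Pi.single j 1) i * x j := by
  have := abs_apply_sub_le hT i j x
  rw [h, sub_self, zero_mul, abs_nonpos_iff] at this
  linarith

/-! ### Rigidity of isometries -/

/-- A contraction close to the identity whose norm attainment set is dense enough is the
identity. -/
theorem eq_id_of_near {B : EllInfty n →L[ℝ] EllInfty n} {ε : ℝ} (hε : ε < 1 / 2)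
    (hB : ‖B‖ ≤ 1) (hBI : ‖B - ContinuousLinearMap.id ℝ (EllInfty n)‖ < ε)
    (h : ∀ y : EllInfty n, ‖y‖ = 1 → ∃ u : EllInfty n, ‖u‖ = 1 ∧ ‖B u‖ = 1 ∧ ‖u - y‖ < ε)
    (x : EllInfty n) : B x = x := by
  ext i
  have he : ‖(Pi.single i 1 : EllInfty n)‖ = 1 := norm_single_one i
  obtain ⟨u, hu, hBu, hue⟩ := h (Pi.single i 1) he
  have hdiff : ∀ v : EllInfty n, ‖v‖ = 1 → ∀ k, |B v k - v k| < ε := fun v hv k => by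
    have h1 := (B - ContinuousLinearMap.id ℝ (EllInfty n)).le_opNorm v
    rw [hv, mul_one] at h1
    exact (norm_le_pi_norm ((B - ContinuousLinearMap.id ℝ (EllInfty n)) v) k).trans_lt (h1.trans_lt hBI)
  have hsmall : ∀ k, k ≠ i → |u k| < ε := fun k hk => by
    have := (norm_le_pi_norm (u - Pi.single i 1) k).trans_lt hue
    simpa [hk] using this
  obtain ⟨k, hk⟩ := (norm_eq_one_iff_exists_abs hBu.le).1 hBu
  -- Off `i`, `|B u k| < |u k| + ε < 2 * ε < 1`; this is where `ε < 1 / 2` is needed.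
  have hki : k = i := by
    by_contra hne
    have h1 := hdiff u hu k
    have h2 := hsmall k hne
    have h3 := abs_sub_abs_le_abs_sub (B u k) (u k)
    linarith
  subst hki
  have hε0 : 0 < ε := (norm_nonneg _).trans_lt hBI
  set b := B (Pi.single k 1) k with hb
  have hb1 : |b| ≤ 1 := (norm_le_pi_norm (B (Pi.single k 1)) k).trans
    ((B.le_of_opNorm_le hB _).trans (by simp [norm_single_one]))
  have hq : |B u k - b * u k| ≤ (1 - |b|) * ε := by
    have h1 := abs_apply_sub_le hB k k (u - u k • Pi.single k 1)
    have h2 : ‖u - u k • (Pi.single k 1 : EllInfty n)‖ ≤ ε := by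
      refine (pi_norm_le_iff_of_nonneg hε0.le).2 fun l => ?_
      by_cases hl : l = k
      · subst hl; simpa using hε0.le
      · simpa [hl] using (hsmall l hl).le
    have h3 : B (u - u k • (Pi.single k 1 : EllInfty n)) k = B u k - b * u k := by
      simp [hb]; ring
    rw [h3] at h1
    simp only [Pi.sub_apply, Pi.smul_apply, Pi.single_eq_same, smul_eq_mul, mul_one, sub_self,
      mul_zero, sub_zero] at h1
    exact h1.trans (mul_le_mul_of_nonneg_left h2 (by linarith))
  have huk : |u k| ≤ 1 := hu ▸ norm_le_pi_norm u k
  have hbu : |b * u k| ≤ |b| := by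
    rw [abs_mul]; exact mul_le_of_le_one_right (abs_nonneg _) huk
  -- Here `1 = |B u k| ≤ |b| + (1 - |b|) * ε` with `ε < 1`.
  have habs : |b| = 1 := by
    have h1 := abs_sub_abs_le_abs_sub (B u k) (b * u k)
    refine le_antisymm hb1 ?_
    nlinarith
  have hb_one : b = 1 := by
    have h1 := hdiff _ he k
    rw [Pi.single_eq_same, ← hb] at h1
    rcases eq_or_eq_neg_of_abs_eq habs with h2 | h2
    · exact h2
    · rw [h2] at h1; norm_num at h1; linarith
  rw [apply_eq_mul_of_abs_eq_one hB habs x, ← hb, hb_one, one_mul]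

/-- Every unit vector norms an isometry, so the `δ` condition is vacuous and `eq_id_of_near` applies
to `A` composed with the inverse of `T`. -/
theorem eq_of_isUniformBPBApprox {T A : EllInfty n →L[ℝ] EllInfty n} (hiso : Isometry T)
    {ε : ℝ} (hε : ε < 1 / 2) (h : IsUniformBPBApprox ε T A) : A = T := by
  obtain ⟨hT, hA, δ, hδ, h⟩ := h
  have hnorm : ∀ x, ‖T x‖ = ‖x‖ := (AddMonoidHomClass.isometry_iff_norm T).1 hiso
  let e : EllInfty n ≃ₗᵢ[ℝ] EllInfty n :=
    LinearIsometry.toLinearIsometryEquiv ⟨(T : EllInfty n →ₗ[ℝ] EllInfty n), hnorm⟩ rfl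
  have he : ∀ x, e x = T x := fun x => rfl
  let B : EllInfty n →L[ℝ] EllInfty n := A.comp (e.symm : EllInfty n →L[ℝ] EllInfty n)
  have hBx : ∀ y, B y = A (e.symm y) := fun y => rfl
  have happ : ∀ x : EllInfty n, ‖x‖ = 1 →
      ∃ u ∈ normAttainmentSet A, ‖u - x‖ < ε ∧ ‖T - A‖ < ε :=
    fun x hx => h x hx (by rw [hnorm, hx]; linarith)
  have hTA : ‖T - A‖ < ε := by
    obtain ⟨x, hx, -⟩ := exists_unit_lt_norm_apply T hT one_pos
    obtain ⟨-, -, -, h⟩ := happ x hx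
    exact h
  have hB : ‖B‖ ≤ 1 := B.opNorm_le_bound zero_le_one fun y => by
    simpa [hBx, hA] using A.le_opNorm (e.symm y)
  have hBI : ‖B - ContinuousLinearMap.id ℝ (EllInfty n)‖ < ε := by
    refine (ContinuousLinearMap.opNorm_le_bound _ (norm_nonneg (T - A)) fun y => ?_).trans_lt hTA
    have h1 : (B - ContinuousLinearMap.id ℝ (EllInfty n)) y = -((T - A) (e.symm y)) := by
      simp [hBx, ← he]
    rw [h1, norm_neg]
    simpa using (T - A).le_opNorm (e.symm y)
  have hid := eq_id_of_near hε hB hBI fun y hy => by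
    obtain ⟨u, hu, hux, -⟩ := happ (e.symm y) (by simpa using hy)
    refine ⟨e u, by simpa using hu.1, by simpa [hBx, hA] using hu.2, ?_⟩
    have h1 : e u - y = e (u - e.symm y) := by simp
    rwa [h1, e.norm_map]
  ext1 x
  have h1 := hid (e x)
  rwa [hBx, e.symm_apply_apply, he] at h1

/-! ### Perturbations of non-isometries -/

/-- If `T` is not an extreme contraction, moving along a segment through `T` keeps the norm
attainment set. -/
theorem exists_approx_of_segment {T R : EllInfty n →L[ℝ] EllInfty n} (hT : ‖T‖ = 1)
    (hR : R ≠ 0) (hadd : ‖T + R‖ ≤ 1) (hsub : ‖T - R‖ ≤ 1) {ε : ℝ} (hε : 0 < ε) :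
    ∃ A, IsNontrivialUniformBPBApprox ε T A ∧ normAttainmentSet T = normAttainmentSet A := by
  have hRpos : 0 < ‖R‖ := norm_pos_iff.2 hR
  obtain ⟨c, hc0, hc⟩ : ∃ c : ℝ, 0 < c ∧ c < min 1 (ε / ‖R‖) :=
    exists_between (lt_min one_pos (div_pos hε hRpos))
  have hc1 : c < 1 := hc.trans_le (min_le_left _ _)
  have hcR : c * ‖R‖ < ε := (lt_div_iff₀ hRpos).1 (hc.trans_le (min_le_right _ _))
  have hcoord : ∀ S : EllInfty n →L[ℝ] EllInfty n, ‖S‖ ≤ 1 → ∀ x : EllInfty n, ‖x‖ = 1 →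
      ∀ i, |S x i| ≤ 1 := fun S hS x hx i =>
    (norm_le_pi_norm (S x) i).trans (by simpa [hx] using S.le_of_opNorm_le hS x)
  have hA : ‖T + c • R‖ ≤ 1 := by
    have h1 : T + c • R = (1 - c) • T + c • (T + R) := by module
    rw [h1]
    refine (norm_add_le _ _).trans ?_
    rw [norm_smul, norm_smul, hT, Real.norm_of_nonneg hc0.le,
      Real.norm_of_nonneg (by linarith : (0 : ℝ) ≤ 1 - c)]
    nlinarith
  refine ⟨T + c • R, isNontrivialUniformBPBApprox_of_norm_eq_one_iff hT hA ?_ ?_ ?_⟩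
  · simpa [norm_smul, abs_of_pos hc0] using hcR
  · simpa using ⟨hc0.ne', hR⟩
  · intro x hx
    have hTx : ‖T x‖ ≤ 1 := by simpa [hx] using T.le_of_opNorm_le hT.le x
    have hAx : ‖(T + c • R) x‖ ≤ 1 := by simpa [hx] using (T + c • R).le_of_opNorm_le hA x
    rw [norm_eq_one_iff_exists_abs hTx, norm_eq_one_iff_exists_abs hAx]
    refine exists_congr fun i => ?_
    have h1 := abs_le.1 (hcoord _ hadd x hx i)
    have h2 := abs_le.1 (hcoord _ hsub x hx i)
    have h3 := abs_le.1 (hcoord _ hT.le x hx i)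
    simp only [add_apply, sub_apply, smul_apply, Pi.add_apply, Pi.sub_apply, Pi.smul_apply,
      smul_eq_mul] at h1 h2 ⊢
    constructor
    · intro h
      -- ±1 are extreme points of `[-1, 1]`.
      have hR0 : R x i = 0 := by
        rcases eq_or_eq_neg_of_abs_eq h with h | h <;> rw [h] at h1 h2 <;>
          linarith [h1.1, h1.2, h2.1, h2.2]
      rw [hR0, mul_zero, add_zero, h]
    · intro h
      rcases eq_or_eq_neg_of_abs_eq h with h | h
      · have : T x i = 1 := by nlinarith [h1.2, h3.2]
        simp [this]
      · have : T x i = -1 := by nlinarith [h1.1, h3.1]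
        simp [this]

/-- Changing a contraction in one row only, it is enough to control that row. -/
theorem norm_add_smulRight_le {T : EllInfty n →L[ℝ] EllInfty n} (hT : ‖T‖ ≤ 1) (i : Fin n)
    (φ : EllInfty n →L[ℝ] ℝ) (h : ∀ x, |T x i + φ x| ≤ ‖x‖) :
    ‖T + φ.smulRight (Pi.single i 1 : EllInfty n)‖ ≤ 1 := by
  refine ContinuousLinearMap.opNorm_le_bound _ zero_le_one fun x => ?_
  rw [one_mul]
  refine (pi_norm_le_iff_of_nonneg (norm_nonneg _)).2 fun k => ?_
  by_cases hk : k = i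
  · subst hk; simpa using h x
  · have := (norm_le_pi_norm (T x) k).trans (T.le_of_opNorm_le hT x)
    simpa [hk] using this

theorem exists_approx_of_row {T : EllInfty n →L[ℝ] EllInfty n} (hT : ‖T‖ = 1) (i : Fin n)
    (φ : EllInfty n →L[ℝ] ℝ) (hφ : φ ≠ 0) (hadd : ∀ x, |T x i + φ x| ≤ ‖x‖)
    (hsub : ∀ x, |T x i - φ x| ≤ ‖x‖) {ε : ℝ} (hε : 0 < ε) :
    ∃ A, IsNontrivialUniformBPBApprox ε T A ∧ normAttainmentSet T = normAttainmentSet A := by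
  refine exists_approx_of_segment (R := φ.smulRight (Pi.single i 1)) hT ?_
    (norm_add_smulRight_le hT.le i φ hadd) ?_ hε
  · intro h0
    refine hφ (ContinuousLinearMap.ext fun x => ?_)
    simpa using congrFun (DFunLike.congr_fun h0 x) i
  · have h1 := norm_add_smulRight_le hT.le i (-φ) (by simpa [sub_eq_add_neg] using hsub)
    convert h1 using 2
    ext x k
    simp [sub_eq_add_neg]

/-- The row `r` moves along `φ = |t| (sgn(t) e_j* - r)`. Then `r + φ` is a convex combination, and
`r - φ` has mass at most `(1 + |t|)(1 - |t|) + |t|² = 1`. -/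
theorem exists_approx_of_entry {T : EllInfty n →L[ℝ] EllInfty n} (hT : ‖T‖ = 1) {i j : Fin n}
    (h0 : T (Pi.single j 1) i ≠ 0) (h1 : |T (Pi.single j 1) i| ≠ 1) {ε : ℝ} (hε : 0 < ε) :
    ∃ A, IsNontrivialUniformBPBApprox ε T A ∧ normAttainmentSet T = normAttainmentSet A := by
  set t := T (Pi.single j 1) i with ht
  have ht1 : |t| ≤ 1 := (norm_le_pi_norm (T (Pi.single j 1)) i).trans
    ((T.le_of_opNorm_le hT.le _).trans (by simp [norm_single_one]))
  let φ : EllInfty n →L[ℝ] ℝ :=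
    t • ContinuousLinearMap.proj j - |t| • (ContinuousLinearMap.proj i).comp T
  have hφ : ∀ x, φ x = t * x j - |t| * T x i := fun x => rfl
  refine exists_approx_of_row hT i φ ?_ (fun x => ?_) (fun x => ?_) hε
  · intro h
    have h2 := DFunLike.congr_fun h (Pi.single j 1)
    rw [hφ, ← ht, Pi.single_eq_same, zero_apply] at h2
    have h3 : (1 - |t|) * t = 0 := by linarith
    rcases mul_eq_zero.1 h3 with h3 | h3
    · exact h1 (by linarith)
    · exact h0 h3
  · have hTx : |T x i| ≤ ‖x‖ := (norm_le_pi_norm (T x) i).trans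
      (by simpa using T.le_of_opNorm_le hT.le x)
    have hxj : |x j| ≤ ‖x‖ := norm_le_pi_norm x j
    have h2 : T x i + φ x = (1 - |t|) * T x i + t * x j := by rw [hφ]; ring
    rw [h2]
    refine (abs_add_le _ _).trans ?_
    rw [abs_mul, abs_mul, abs_of_nonneg (by linarith : 0 ≤ 1 - |t|)]
    nlinarith [abs_nonneg t]
  · have hq := abs_apply_sub_le hT.le i j x
    rw [← ht] at hq
    have hxj : |x j| ≤ ‖x‖ := norm_le_pi_norm x j
    have h2 : T x i - φ x = (1 + |t|) * (T x i - t * x j) + |t| * (t * x j) := by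
      rw [hφ]; ring
    rw [h2]
    refine (abs_add_le _ _).trans ?_
    rw [abs_mul, abs_mul |t|, abs_mul t, abs_abs, abs_of_nonneg (by positivity : 0 ≤ 1 + |t|)]
    calc (1 + |t|) * |T x i - t * x j| + |t| * (|t| * |x j|)
        ≤ (1 + |t|) * ((1 - |t|) * ‖x‖) + |t| * (|t| * ‖x‖) := by gcongr
      _ = ‖x‖ := by ring

theorem exists_approx_of_zero_row {T : EllInfty n →L[ℝ] EllInfty n} (hT : ‖T‖ = 1) {i : Fin n}
    (h : ∀ x, T x i = 0) {ε : ℝ} (hε : 0 < ε) :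
    ∃ A, IsNontrivialUniformBPBApprox ε T A ∧ normAttainmentSet T = normAttainmentSet A := by
  refine exists_approx_of_row hT i (ContinuousLinearMap.proj i) ?_ (fun x => ?_) (fun x => ?_) hε
  · intro h0
    simpa using DFunLike.congr_fun h0 (Pi.single i 1 : EllInfty n)
  · simpa [h] using norm_le_pi_norm x i
  · simpa [h] using norm_le_pi_norm x i

/-- If two rows agree up to sign, one of them may be shrunk. -/
theorem exists_approx_of_parallel_rows {T : EllInfty n →L[ℝ] EllInfty n} (hT : ‖T‖ = 1)
    {i k : Fin n} (hik : i ≠ k) (habs : ∀ x, |T x i| = |T x k|)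
    {z : EllInfty n} (hz : T z k ≠ 0) {ε : ℝ} (hε : 0 < ε) :
    ∃ A, IsNontrivialUniformBPBApprox ε T A ∧ normAttainmentSet T = normAttainmentSet A := by
  obtain ⟨c, hc0, hc⟩ : ∃ c : ℝ, 0 < c ∧ c < min 1 ε := exists_between (lt_min one_pos hε)
  have hc1 : c < 1 := hc.trans_le (min_le_left _ _)
  have hcε : c < ε := hc.trans_le (min_le_right _ _)
  let D : EllInfty n →L[ℝ] EllInfty n :=
    (c • (ContinuousLinearMap.proj k).comp T : EllInfty n →L[ℝ] ℝ).smulRight (Pi.single k 1)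
  have hDk : ∀ x, D x k = c * T x k := fun x => by simp [D]
  have hDl : ∀ x l, l ≠ k → D x l = 0 := fun x l hl => by simp [D, hl]
  have hAl : ∀ x l, |(T - D) x l| ≤ |T x l| := fun x l => by
    by_cases hl : l = k
    · subst hl
      have : (T - D) x l = (1 - c) * T x l := by
        rw [sub_apply, Pi.sub_apply, hDk]; ring
      rw [this, abs_mul, abs_of_pos (by linarith)]
      nlinarith [abs_nonneg (T x l)]
    · rw [sub_apply, Pi.sub_apply, hDl x l hl, sub_zero]
  -- Row `i` is untouched and still carries the modulus lost in row `k`.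
  have hnorm : ∀ x, ‖(T - D) x‖ = ‖T x‖ := fun x => by
    apply le_antisymm
    · exact (pi_norm_le_iff_of_nonneg (norm_nonneg _)).2 fun l =>
        (hAl x l).trans (norm_le_pi_norm (T x) l)
    · refine (pi_norm_le_iff_of_nonneg (norm_nonneg _)).2 fun l => ?_
      have hl : ∀ l, l ≠ k → |T x l| ≤ ‖(T - D) x‖ := fun l hl => by
        simpa [hDl x l hl] using norm_le_pi_norm ((T - D) x) l
      by_cases h : l = k
      · subst h
        exact (habs x).symm.le.trans (hl i hik)
      · exact hl l h
  refine ⟨T - D, isNontrivialUniformBPBApprox_of_norm_eq_one_iff hT ?_ ?_ ?_ ?_⟩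
  · exact ContinuousLinearMap.opNorm_le_bound _ zero_le_one fun x => by
      rw [hnorm]; exact T.le_of_opNorm_le hT.le x
  · rw [sub_sub_cancel]
    refine (ContinuousLinearMap.opNorm_le_bound _ hc0.le fun x => ?_).trans_lt hcε
    refine (pi_norm_le_iff_of_nonneg (by positivity)).2 fun l => ?_
    by_cases h : l = k
    · subst h
      rw [hDk, norm_mul, Real.norm_of_nonneg hc0.le]
      gcongr
      exact (norm_le_pi_norm (T x) l).trans (by simpa using T.le_of_opNorm_le hT.le x)
    · rw [hDl x l h, norm_zero]
      positivity
  · intro h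
    have h1 := congrFun (DFunLike.congr_fun h z) k
    rw [sub_apply, Pi.sub_apply, hDk, sub_eq_self] at h1
    exact (mul_ne_zero hc0.ne' hz) h1
  · intro x _
    rw [hnorm]

theorem isometry_of_signed_permutation {T : EllInfty n →L[ℝ] EllInfty n} {σ : Fin n → Fin n}
    (hσ : Function.Injective σ) (h : ∀ x i, |T x i| = |x (σ i)|) : Isometry T := by
  refine (AddMonoidHomClass.isometry_iff_norm T).2 fun x => le_antisymm ?_ ?_
  · exact (pi_norm_le_iff_of_nonneg (norm_nonneg _)).2 fun i =>
      (h x i).le.trans (norm_le_pi_norm x (σ i))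
  · refine (pi_norm_le_iff_of_nonneg (norm_nonneg _)).2 fun j => ?_
    obtain ⟨i, rfl⟩ := Finite.surjective_of_injective hσ j
    exact (h x i).symm.le.trans (norm_le_pi_norm (T x) i)

theorem hasNontrivialNormPreservingUniformBPB (n : ℕ) :
    HasNontrivialNormPreservingUniformBPB (EllInfty n) (EllInfty n) := by
  intro T hT hiso ε hε
  by_cases hentry : ∃ i j, T (Pi.single j 1) i ≠ 0 ∧ |T (Pi.single j 1) i| ≠ 1
  · obtain ⟨i, j, h0, h1⟩ := hentry
    exact exists_approx_of_entry hT h0 h1 hε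
  by_cases hrow : ∃ i, ∀ j, T (Pi.single j 1) i = 0
  · obtain ⟨i, hi⟩ := hrow
    exact exists_approx_of_zero_row hT (i := i) (fun x => by simp [apply_eq_sum T x, hi]) hε
  push Not at hentry hrow
  choose σ hσ using hrow
  have habs1 : ∀ i, |T (Pi.single (σ i) 1) i| = 1 := fun i => hentry i (σ i) (hσ i)
  have habs : ∀ x i, |T x i| = |x (σ i)| := fun x i => by
    rw [apply_eq_mul_of_abs_eq_one hT.le (habs1 i) x, abs_mul, habs1, one_mul]
  have hinj : ¬ Function.Injective σ := fun h => hiso (isometry_of_signed_permutation h habs)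
  simp only [Function.Injective, not_forall] at hinj
  obtain ⟨i, k, hik, hne⟩ := hinj
  exact exists_approx_of_parallel_rows hT hne (fun x => by rw [habs, habs, hik]) (hσ k) hε

theorem isUniformBPBApprox_self (T : EllInfty n →L[ℝ] EllInfty n) (hT : ‖T‖ = 1) {ε : ℝ}
    (hε : 0 < ε) : IsUniformBPBApprox ε T T := by
  obtain ⟨δ, hδ, h⟩ := exists_near_normAttainmentSet T hT hε
  refine ⟨hT, hT, δ, hδ, fun x hx hTx => ?_⟩
  obtain ⟨u, hu, hux⟩ := h x hx hTx
  exact ⟨u, hu, hux, by simpa using hε⟩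

end EllInfty

end BPB

theorem mainTheorem7 (n : ℕ) :
    (∀ T : BPB.EllInfty n →L[ℝ] BPB.EllInfty n, ‖T‖ = 1 →
      (Isometry T ↔
        ∃ ε₀ : ℝ, 0 < ε₀ ∧ ∀ ε : ℝ, 0 < ε → ε < ε₀ →
          ∀ A : BPB.EllInfty n →L[ℝ] BPB.EllInfty n,
            BPB.IsUniformBPBApprox ε T A ↔ A = T)) ∧
    BPB.HasNontrivialNormPreservingUniformBPB (BPB.EllInfty n) (BPB.EllInfty n) := by
  refine ⟨fun T hT => ⟨fun hiso => ?_, ?_⟩, BPB.hasNontrivialNormPreservingUniformBPB n⟩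
  · refine ⟨1 / 2, by norm_num, fun ε hε hε' A => ⟨BPB.eq_of_isUniformBPBApprox hiso hε', ?_⟩⟩
    rintro rfl
    exact BPB.isUniformBPBApprox_self A hT hε
  · rintro ⟨ε₀, hε₀, h⟩
    by_contra hiso
    obtain ⟨A, ⟨hA, hne⟩, -⟩ :=
      BPB.hasNontrivialNormPreservingUniformBPB n T hT hiso (ε₀ / 2) (half_pos hε₀)
    exact hne ((h (ε₀ / 2) (half_pos hε₀) (half_lt_self hε₀) A).1 hA)
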